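/- All posets are finite. Let $P$ be a finite graded poset with a least element $\hat 0$, a greatest element $\hat 1$ and rank function $\rho$ (so $\rho(\hat 0)=0$); an interval $[x,y]$ with $\rho(y)-\rho(x)=n$ is called an $n$-interval, and the rank of $P$ is $\rho(\hat 1)$. $P$ is \emph{Eulerian} if every interval $[x,y]$ with $x<y$ contains as many elements of even rank as of odd rank. $P$ is a \emph{Sheffer poset} if for every $n$ all $n$-intervals $[\hat 0,y]$ have the same number $D(n)$ of maximal chains and all $n$-intervals $[x,y]$ with $x\neq\hat 0$ have the same number $B(n)$ of maximal chains. $B_n$ denotes the boolean lattice of subsets of an $n$-element set. For a poset $Q$ with a least element $\hat 0$, the dual suspension $\Sigma^{*}(Q)$ is $Q$ together with two new incomparable elements $a_1,a_2$ satisfying $\hat 0<a_i<y$ for all $y>\hat 0$ in $Q$. For a poset $Q$ with $\hat 0\ne\hat 1$ and a positive integer $\alpha$, the $\alpha$-summation $\boxplus^{\alpha}(Q)$ is the poset obtained from $\alpha$ disjoint copies of $Q$ by identifying all their least elements and identifying all their greatest elements. \textbf{Theorem.} Let $P$ be an Eulerian Sheffer poset of odd rank $2m+1\ge 5$ with $B(3)=6$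 and $D(3)=4$. Then there is an integer $\alpha\ge 1$ such that $P$ is isomorphic to $\boxplus^{\alpha}(\Sigma^{*}(B_{2m}))$. -/

import Mathlib

namespace EulerianSheffer

/-! Finite posets with a least element, a greatest element and a rank function.
Gradedness is Mathlib's `GradeMinOrder ℕ P`: the rank function `grade ℕ` is strictly monotone,
increases by exactly one along covers, and vanishes at the least element. -/

section Poset

variable (P : Type*) [PartialOrder P] [BoundedOrder P] [GradeMinOrder ℕ P]

/-- A graded poset is Eulerian if every non-singleton interval has as many elements of even rank
as of odd rank. (Measuring ranks in `P` instead of in the interval at most swaps the two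
classes.) -/
def IsEulerian : Prop :=
  ∀ x y : P, x < y →
    {z ∈ Set.Icc x y | Even (grade ℕ z)}.ncard = {z ∈ Set.Icc x y | Odd (grade ℕ z)}.ncard

variable {P} in
/-- The number of maximal chains of the interval `[x, y]`. -/
noncomputable def numMaxChains (x y : P) : ℕ := Nat.card (Flag (Set.Icc x y))

/-- A Sheffer poset: any two `n`-intervals `[⊥, y]`, `[⊥, v]` have the same number of maximal
chains, and any two `n`-intervals `[x, y]`, `[u, v]` with `x ≠ ⊥`, `u ≠ ⊥` have the same number
of maximal chains. -/
structure IsSheffer : Prop where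
  sheffer_interval : ∀ (n : ℕ) (y v : P), grade ℕ y = n → grade ℕ v = n →
    numMaxChains ⊥ y = numMaxChains ⊥ v
  binomial_interval : ∀ (n : ℕ) (x y u v : P), x ≠ ⊥ → u ≠ ⊥ → x ≤ y → u ≤ v →
    grade ℕ y = grade ℕ x + n → grade ℕ v = grade ℕ u + n →
    numMaxChains x y = numMaxChains u v

/-- `B` is the binomial factorial function of `P`: every `n`-interval `[x, y]` with `x ≠ ⊥` has
`B n` maximal chains. -/
def IsBinomialFactorialFunction (B : ℕ → ℕ) : Prop :=
  ∀ (n : ℕ) (x y : P), x ≠ ⊥ → x ≤ y → grade ℕ y = grade ℕ x + n → numMaxChains x y = B n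

/-- `D` is the Sheffer factorial function of `P`: every `n`-interval `[⊥, y]` has
`D n` maximal chains. -/
def IsShefferFactorialFunction (D : ℕ → ℕ) : Prop :=
  ∀ (n : ℕ) (y : P), grade ℕ y = n → numMaxChains ⊥ y = D n

end Poset

/-- The dual suspension `Σ*(P)` of a poset `P` with least element: the elements of `P` together
with two new elements. -/
inductive DualSuspension (P : Type*) : Type _
  | of (x : P) : DualSuspension P
  | new (i : Fin 2) : DualSuspension P

namespace DualSuspension

variable {P : Type*} [PartialOrder P] [OrderBot P]

/-- The order of `Σ*(P)`: the order of `P` on old elements; the two new elements are incomparable,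
lie above `⊥` and lie below every other old element. -/
protected def le : DualSuspension P → DualSuspension P → Prop
  | of x, of y => x ≤ y
  | of x, new _ => x = ⊥
  | new _, of y => ⊥ < y
  | new i, new j => i = j

instance : PartialOrder (DualSuspension P) where
  le := DualSuspension.le
  le_refl a := by cases a <;> simp [DualSuspension.le]
  le_trans a b c := by
    cases a <;> cases b <;> cases c <;> simp only [DualSuspension.le]
    · exact le_trans
    · rintro h rfl
      exact le_bot_iff.mp h
    · rintro rfl -
      exact bot_le
    · rintro h rfl
      exact h
    · exact lt_of_lt_of_le
    · rintro h rfl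
      exact absurd h (lt_irrefl _)
    · rintro rfl h
      exact h
    · exact Eq.trans
  le_antisymm a b := by
    cases a <;> cases b <;> simp only [DualSuspension.le]
    · intro h h'
      rw [le_antisymm h h']
    · rintro rfl h
      exact absurd h (lt_irrefl _)
    · rintro h rfl
      exact absurd h (lt_irrefl _)
    · rintro rfl -
      rfl

end DualSuspension

/-- The `k`-summation `⊞^k(P)` of a poset `P` with least element `0̂`, greatest element `1̂ ≠ 0̂`:
`k` copies of `P` with all least elements identified and all greatest elements identified.
Its elements are a common bottom, a common top, and the disjoint union (with no relations between
different copies) of `k` copies of `P \ {0̂, 1̂}`; in such a `P` the elements different from `0̂`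
and `1̂` are those that are neither minimal nor maximal. -/
abbrev KSummation (k : ℕ) (P : Type*) [PartialOrder P] : Type _ :=
  WithBot (WithTop (Σ _ : Fin k, {x : P // ¬ IsMin x ∧ ¬ IsMax x}))

/-- The boolean lattice of rank `n`: subsets of an `n`-element set ordered by inclusion. -/
abbrev BooleanLattice (n : ℕ) : Type := Finset (Fin n)

end EulerianSheffer

/-!
Counting flags in an interval whose proper subintervals are understood expresses the sizes of its
layers through the numbers of atoms of its maximal proper subintervals. On an interval of even rank
`l + 3` the Eulerian condition, that the alternating sum of the layer sizes vanishes, becomes a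
relation between the number `A` of its atoms and the number `a` of atoms of its subintervals of
corank one.

Above the atoms of `P` this relation is `A * a + (l + 3) = A * (l + 3)`, so `a < l + 3`. For
`l = 1`, `B 3 = 6` gives `a = 3`. For larger `l`, two elements of rank two in a corank-one interval
cannot have the same two atoms, and a double count gives `a ≥ l + 2`. Hence `a = l + 2` and
`A = l + 3`; by induction, every `[x, ⊤]` with `x ≠ ⊥` has the atom counts of a boolean lattice, and
then it is one.

For the intervals `[⊥, y]`, the relation is `a * (A * l + 4) = 2 * (A * (l + 2))`. For `l = 1`,
`D 3 = 4` gives `a = 2`; it also shows that elements of rank two above a common atom have the same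
two atoms, so atoms come in pairs and `a` is even. For larger `l` the relation forces `a < 4`, so
again `a = 2`, and then `A = 2`. Every element of rank at least two other than `⊤` therefore lies
above exactly one pair of atoms. The elements above a given pair, together with `⊥`, form a
`Σ*(B_{2m})`, and different pairs have only `⊤` above both.
-/

namespace EulerianSheffer

section MaximalChains

variable {P : Type*} [PartialOrder P] {x y p q : P} {C C' : Set P}

/-- `C` is a maximal chain of the interval `[x, y]`, as a set of elements of the ambient poset;
this makes chains of different intervals comparable, unlike `Flag (Set.Icc x y)`. -/
structure IsMaxChainIcc (x y : P) (C : Set P) : Prop where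
  subset : C ⊆ Set.Icc x y
  chain : IsChain (· ≤ ·) C
  mem_of_forall : ∀ z ∈ Set.Icc x y, (∀ c ∈ C, z ≤ c ∨ c ≤ z) → z ∈ C

theorem IsMaxChainIcc.left_mem (h : IsMaxChainIcc x y C) (hxy : x ≤ y) : x ∈ C :=
  h.mem_of_forall x ⟨le_rfl, hxy⟩ fun _ hc => Or.inl (h.subset hc).1

theorem IsMaxChainIcc.right_mem (h : IsMaxChainIcc x y C) (hxy : x ≤ y) : y ∈ C :=
  h.mem_of_forall y ⟨hxy, le_rfl⟩ fun _ hc => Or.inr (h.subset hc).2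

theorem IsMaxChainIcc.insert (h : IsMaxChainIcc p y C) (hx : x ⋖ p) (hp : p ≤ y) :
    IsMaxChainIcc x y (insert x C) where
  subset := Set.insert_subset ⟨le_rfl, hx.le.trans hp⟩
    (h.subset.trans (Set.Icc_subset_Icc_left hx.le))
  chain := h.chain.insert fun _ hc _ => Or.inl (hx.le.trans (h.subset hc).1)
  mem_of_forall z hz hc := by
    rcases hc p (Or.inr (h.left_mem hp)) with hzp | hpz
    · rcases hx.eq_or_eq hz.1 hzp with rfl | rfl
      · exact Or.inl rfl
      · exact Or.inr (h.left_mem hp)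
    · exact Or.inr (h.mem_of_forall z ⟨hpz, hz.2⟩ fun c hcC => hc c (Or.inr hcC))

theorem IsMaxChainIcc.exists_covBy [Finite P] (h : IsMaxChainIcc x y C) (hxy : x < y) :
    ∃ p, x ⋖ p ∧ p ≤ y ∧ IsMaxChainIcc p y (C \ {x}) := by
  obtain ⟨p, hp, hmin⟩ := (Set.toFinite (C \ {x})).exists_minimal
    ⟨y, h.right_mem hxy.le, hxy.ne'⟩
  have hle : ∀ c ∈ C \ {x}, p ≤ c := fun c hc =>
    (h.chain.total hp.1 hc.1).elim id fun hcp => hmin hc hcp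
  have hxp : x < p := lt_of_le_of_ne (h.subset hp.1).1 (Ne.symm hp.2)
  have hpy : p ≤ y := (h.subset hp.1).2
  have mem_of_forall (z : P) (hxz : x < z) (hzy : z ≤ y)
      (hz : ∀ c ∈ C \ {x}, z ≤ c ∨ c ≤ z) : z ∈ C \ {x} := by
    refine ⟨h.mem_of_forall z ⟨hxz.le, hzy⟩ fun c hc => ?_, hxz.ne'⟩
    by_cases hcx : c = x
    · exact Or.inr (hcx ▸ hxz.le)
    · exact hz c ⟨hc, hcx⟩
  refine ⟨p, ⟨hxp, fun z hxz hzp => hzp.not_ge (hle z ?_)⟩, hpy,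
    fun z hz => ⟨hle z hz, (h.subset hz.1).2⟩, h.chain.mono Set.sdiff_subset,
    fun z hz => mem_of_forall z (hxp.trans_le hz.1) hz.2⟩
  exact mem_of_forall z hxz (hzp.le.trans hpy) fun c hc => Or.inl (hzp.le.trans (hle c hc))

theorem IsMaxChainIcc.insert_inj (hC : IsMaxChainIcc p y C) (hC' : IsMaxChainIcc q y C')
    (hp : x ⋖ p) (hq : x ⋖ q) (hpy : p ≤ y) (hqy : q ≤ y)
    (h : Insert.insert x C = Insert.insert x C') : p = q ∧ C = C' := by
  have hxC : x ∉ C := fun hx => hp.lt.not_ge (hC.subset hx).1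
  have hxC' : x ∉ C' := fun hx => hq.lt.not_ge (hC'.subset hx).1
  obtain rfl : C = C' := by
    rw [← Set.insert_sdiff_self_of_notMem hxC, h, Set.insert_sdiff_self_of_notMem hxC']
  exact ⟨le_antisymm (hC.subset (hC'.left_mem hqy)).1 (hC'.subset (hC.left_mem hpy)).1, rfl⟩

/-- The correspondence between the maximal chains of the type `[x, y]` and their images in `P`. -/
def flagIccEquiv (x y : P) : Flag (Set.Icc x y) ≃ {C : Set P // IsMaxChainIcc x y C} where
  toFun F := ⟨Subtype.val '' (F : Set (Set.Icc x y)), by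
    refine ⟨Subtype.coe_image_subset _ _, ?_, fun z hz hc => ⟨⟨z, hz⟩, ?_, rfl⟩⟩
    · rintro _ ⟨a, ha, rfl⟩ _ ⟨b, hb, rfl⟩ -
      exact F.le_or_le ha hb
    · exact Flag.mem_iff_forall_le_or_ge.2 fun b hb => hc b ⟨b, hb, rfl⟩⟩
  invFun C := Flag.ofIsMaxChain (Subtype.val ⁻¹' C.1) <| by
    refine ⟨fun a ha b hb _ => C.2.chain.total ha hb, fun t ht hCt => hCt.antisymm fun z hz =>
      C.2.mem_of_forall z z.2 fun c hc => ?_⟩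
    exact ht.total hz (hCt (a := ⟨c, C.2.subset hc⟩) hc)
  left_inv F := by
    ext z
    simp
  right_inv C := Subtype.ext <| Subtype.image_preimage_coe _ _ |>.trans <|
    Set.inter_eq_right.2 C.2.subset

theorem numMaxChains_eq_card (x y : P) :
    numMaxChains x y = Nat.card {C : Set P // IsMaxChainIcc x y C} :=
  Nat.card_congr (flagIccEquiv x y)

theorem numMaxChains_self (x : P) : numMaxChains x x = 1 := by
  rw [numMaxChains_eq_card, Nat.card_eq_one_iff_unique]
  have eq_singleton (C : {C : Set P // IsMaxChainIcc x x C}) : C.1 = {x} :=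
    (Set.subset_singleton_iff.2 fun _ hz =>
      le_antisymm (C.2.subset hz).2 (C.2.subset hz).1).antisymm
      (Set.singleton_subset_iff.2 (C.2.left_mem le_rfl))
  exact ⟨⟨fun C C' => Subtype.ext ((eq_singleton C).trans (eq_singleton C').symm)⟩,
    (flagIccEquiv x x).symm.nonempty⟩

theorem numMaxChains_pos [Finite P] (x y : P) : 0 < numMaxChains x y :=
  Nat.card_pos

end MaximalChains

section Layers

theorem eq_of_le_of_grade_le {P : Type*} [PartialOrder P] [GradeOrder ℕ P] {x y : P}
    (h : x ≤ y) (hr : grade ℕ y ≤ grade ℕ x) : x = y :=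
  h.eq_of_not_lt fun hlt => (grade_strictMono (𝕆 := ℕ) hlt).not_ge hr

variable {P : Type*} [Finite P] [PartialOrder P] [GradeOrder ℕ P] {x y z p e u v : P} {i j n : ℕ}

/-- The elements of the interval `[x, y]` whose rank in this interval is `j`. -/
noncomputable def layer (x y : P) (j : ℕ) : Finset P :=
  (Set.toFinite {z | x ≤ z ∧ z ≤ y ∧ grade ℕ z = grade ℕ x + j}).toFinset

theorem mem_layer : z ∈ layer x y j ↔ x ≤ z ∧ z ≤ y ∧ grade ℕ z = grade ℕ x + j := by
  simp [layer]

theorem mem_layer_one_iff_covBy : p ∈ layer x y 1 ↔ x ⋖ p ∧ p ≤ y := by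
  rw [mem_layer]
  constructor
  · rintro ⟨hxp, hpy, hp⟩
    have hlt : x < p := lt_of_le_of_ne hxp (by rintro rfl; omega)
    refine ⟨⟨hlt, fun z hxz hzp => ?_⟩, hpy⟩
    have := grade_strictMono (𝕆 := ℕ) hxz
    have := grade_strictMono (𝕆 := ℕ) hzp
    omega
  · rintro ⟨hxp, hpy⟩
    exact ⟨hxp.le, hpy, (Nat.covBy_iff_add_one_eq.1 (hxp.grade ℕ)).symm⟩

theorem layer_zero (h : x ≤ y) : layer x y 0 = {x} := by
  ext z
  rw [mem_layer, Finset.mem_singleton]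
  constructor
  · rintro ⟨hxz, -, hz⟩
    exact (eq_of_le_of_grade_le hxz hz.le).symm
  · rintro rfl
    exact ⟨le_rfl, h, rfl⟩

theorem layer_top (h : x ≤ y) (hn : grade ℕ y = grade ℕ x + n) : layer x y n = {y} := by
  ext z
  rw [mem_layer, Finset.mem_singleton]
  constructor
  · rintro ⟨-, hzy, hz⟩
    exact eq_of_le_of_grade_le hzy (hn.trans hz.symm).le
  · rintro rfl
    exact ⟨h, le_rfl, hn⟩

theorem layer_mono_right (h : y ≤ z) : layer x y j ⊆ layer x z j := fun p hp => by
  rw [mem_layer] at hp ⊢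
  exact ⟨hp.1, hp.2.1.trans h, hp.2.2⟩

theorem mem_layer_of_le_right (hp : p ∈ layer x y j) (hpz : p ≤ z) : p ∈ layer x z j :=
  mem_layer.2 ⟨(mem_layer.1 hp).1, hpz, (mem_layer.1 hp).2.2⟩

theorem mem_layer_trans (hp : p ∈ layer x y i) (he : e ∈ layer p y j) : e ∈ layer x y (i + j) := by
  rw [mem_layer] at *
  exact ⟨hp.1.trans he.1, he.2.1, by omega⟩

theorem mem_layer_of_le (hp : p ∈ layer x y i) (he : e ∈ layer x y (i + j)) (hpe : p ≤ e) :
    e ∈ layer p y j := by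
  rw [mem_layer] at *
  exact ⟨hpe, he.2.1, by omega⟩

theorem layer_nonempty (h : x ≤ y) (hj : grade ℕ x + j ≤ grade ℕ y) : (layer x y j).Nonempty := by
  induction j generalizing x with
  | zero => exact ⟨x, by simp [layer_zero h]⟩
  | succ j ih =>
    obtain ⟨p, hxp, hpy⟩ := exists_covBy_le_of_lt (h.lt_of_ne (by rintro rfl; omega))
    have hp : p ∈ layer x y 1 := mem_layer_one_iff_covBy.2 ⟨hxp, hpy⟩
    obtain ⟨z, hz⟩ := ih hpy (by have := (mem_layer.1 hp).2.2; omega)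
    exact ⟨z, add_comm 1 j ▸ mem_layer_trans hp hz⟩

theorem sum_card_layer_one (x y : P) (j : ℕ) :
    ∑ z ∈ layer x y (j + 1), (layer x z 1).card = ∑ p ∈ layer x y 1, (layer p y j).card := by
  classical
  convert Finset.sum_card_bipartiteAbove_eq_sum_card_bipartiteBelow (s := layer x y (j + 1))
    (t := layer x y 1) (fun z p => p ≤ z) using 3 with z hz p hp
  · ext p
    simp only [Finset.mem_bipartiteAbove, mem_layer] at hz ⊢
    exact ⟨fun h => ⟨⟨h.1, h.2.1.trans hz.2.1, h.2.2⟩, h.2.1⟩, fun h => ⟨h.1.1, h.2, h.1.2.2⟩⟩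
  · ext z
    rw [Finset.mem_bipartiteBelow, add_comm j 1]
    exact ⟨fun h => ⟨mem_layer_trans hp h, (mem_layer.1 h).1⟩,
      fun h => mem_layer_of_le hp h.1 h.2⟩

theorem sum_Icc_eq_sum_layer {M : Type*} [AddCommMonoid M] (f : P → M)
    (hn : grade ℕ y = grade ℕ x + n) :
    ∑ z ∈ (Set.toFinite (Set.Icc x y)).toFinset, f z =
      ∑ j ∈ Finset.range (n + 1), ∑ z ∈ layer x y j, f z := by
  classical
  rw [← Finset.sum_fiberwise_of_maps_to (t := Finset.range (n + 1))
    (g := fun z => grade ℕ z - grade ℕ x)]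
  · refine Finset.sum_congr rfl fun j _ => Finset.sum_congr ?_ fun _ _ => rfl
    ext z
    simp only [Finset.mem_filter, Set.Finite.mem_toFinset, Set.mem_Icc, mem_layer, and_assoc]
    refine and_congr_right fun hxz => and_congr_right fun _ => ?_
    have := grade_mono (𝕆 := ℕ) hxz
    omega
  · intro z hz
    rw [Set.Finite.mem_toFinset] at hz
    have := grade_mono (𝕆 := ℕ) hz.2
    rw [Finset.mem_range]
    omega

theorem card_layer_succ_mul {c M w : ℕ} (hc : ∀ z ∈ layer x y (j + 1), (layer x z 1).card = c)
    (hw : ∀ p ∈ layer x y 1, (layer p y j).card * M = w) :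
    (layer x y (j + 1)).card * (c * M) = (layer x y 1).card * w := by
  rw [← mul_assoc, ← smul_eq_mul (layer x y (j + 1)).card c, ← Finset.sum_const,
    ← Finset.sum_congr rfl hc, sum_card_layer_one, Finset.sum_mul, Finset.sum_congr rfl hw,
    Finset.sum_const, smul_eq_mul]

theorem card_layer_succ_mul_choose {M w : ℕ}
    (hc : ∀ z ∈ layer x y (j + 1), (layer x z 1).card = j + 1)
    (hw : ∀ p ∈ layer x y 1, (layer p y j).card * M = w * n.choose j) :
    (layer x y (j + 1)).card * ((n + 1) * M) =
      (layer x y 1).card * w * (n + 1).choose (j + 1) := by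
  have h := card_layer_succ_mul hc hw
  have hchoose := Nat.add_one_mul_choose_eq n j
  refine Nat.eq_of_mul_eq_mul_right j.succ_pos ?_
  calc (layer x y (j + 1)).card * ((n + 1) * M) * (j + 1)
      = (n + 1) * ((layer x y (j + 1)).card * ((j + 1) * M)) := by ring
    _ = (layer x y 1).card * w * ((n + 1) * n.choose j) := by rw [h]; ring
    _ = (layer x y 1).card * w * (n + 1).choose (j + 1) * (j + 1) := by rw [hchoose]; ring

theorem numMaxChains_eq_sum (h : x < y) :
    numMaxChains x y = ∑ p ∈ layer x y 1, numMaxChains p y := by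
  let f : (Σ p : layer x y 1, {C : Set P // IsMaxChainIcc (p : P) y C}) →
      {C : Set P // IsMaxChainIcc x y C} := fun c =>
    have hp := mem_layer_one_iff_covBy.1 c.1.2
    ⟨insert x c.2.1, c.2.2.insert hp.1 hp.2⟩
  have hf : f.Bijective := by
    constructor
    · rintro ⟨⟨p, hp⟩, C, hC⟩ ⟨⟨q, hq⟩, C', hC'⟩ hCC'
      rw [mem_layer_one_iff_covBy] at hp hq
      obtain ⟨rfl, rfl⟩ := hC.insert_inj hC' hp.1 hq.1 hp.2 hq.2 (congrArg Subtype.val hCC')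
      rfl
    · rintro ⟨C, hC⟩
      obtain ⟨p, hxp, hpy, hCp⟩ := hC.exists_covBy h
      exact ⟨⟨⟨p, mem_layer_one_iff_covBy.2 ⟨hxp, hpy⟩⟩, C \ {x}, hCp⟩,
        Subtype.ext (Set.insert_sdiff_self_of_mem (hC.left_mem h.le))⟩
  rw [numMaxChains_eq_card, ← Nat.card_congr (Equiv.ofBijective f hf), Nat.card_sigma,
    ← Finset.sum_coe_sort (layer x y 1) fun p => numMaxChains p y]
  exact Finset.sum_congr rfl fun p _ => (numMaxChains_eq_card (p : P) y).symm

theorem numMaxChains_eq_card_mul (h : x < y) {b : ℕ}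
    (hb : ∀ p ∈ layer x y 1, numMaxChains p y = b) :
    numMaxChains x y = (layer x y 1).card * b := by
  rw [numMaxChains_eq_sum h, Finset.sum_const_nat hb]

theorem card_layer_one_eq_of_numMaxChains_eq (hxy : x < y) (huv : u < v)
    (h : numMaxChains x y = numMaxChains u v)
    (hatoms : ∀ p ∈ layer x y 1, ∀ q ∈ layer u v 1, numMaxChains p y = numMaxChains q v) :
    (layer x y 1).card = (layer u v 1).card := by
  obtain ⟨p, hp⟩ : (layer x y 1).Nonempty :=
    layer_nonempty hxy.le (grade_strictMono (𝕆 := ℕ) hxy)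
  obtain ⟨q, hq⟩ : (layer u v 1).Nonempty :=
    layer_nonempty huv.le (grade_strictMono (𝕆 := ℕ) huv)
  have hx := numMaxChains_eq_card_mul hxy fun p' hp' => hatoms p' hp' q hq
  have hu := numMaxChains_eq_card_mul huv fun q' hq' =>
    (hatoms p hp q' hq').symm.trans (hatoms p hp q hq)
  exact Nat.eq_of_mul_eq_mul_right (numMaxChains_pos q v) (hx.symm.trans (h.trans hu))

end Layers

section BooleanIntervals

variable {P : Type*} [Finite P] [PartialOrder P] [GradeOrder ℕ P] {x y z w u v p e e' : P}
  {j n : ℕ}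

/-- Every subinterval of `[x, y]` has as many atoms as its rank: the numerical condition that
characterises the intervals which are boolean lattices. -/
def HasBooleanAtomCounts (x y : P) : Prop :=
  ∀ u v : P, x ≤ u → u ≤ v → v ≤ y → grade ℕ u + (layer u v 1).card = grade ℕ v

namespace HasBooleanAtomCounts

theorem mono (h : HasBooleanAtomCounts x y) (hu : x ≤ u) (hv : v ≤ y) :
    HasBooleanAtomCounts u v :=
  fun _ _ hs hst ht => h _ _ (hu.trans hs) hst (ht.trans hv)

theorem card_layer_one (h : HasBooleanAtomCounts x y) (hxy : x ≤ y)
    (hn : grade ℕ y = grade ℕ x + n) : (layer x y 1).card = n := by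
  have := h x y le_rfl hxy le_rfl
  omega

theorem card_layer_one_of_mem_layer (h : HasBooleanAtomCounts x y) (hz : z ∈ layer x y j) :
    (layer x z 1).card = j :=
  have ⟨hxz, hzy, hj⟩ := mem_layer.1 hz
  (h.mono le_rfl hzy).card_layer_one hxz hj

theorem card_layer (h : HasBooleanAtomCounts x y) (hxy : x ≤ y)
    (hn : grade ℕ y = grade ℕ x + n) (j : ℕ) : (layer x y j).card = n.choose j := by
  induction j generalizing x n with
  | zero => rw [layer_zero hxy, Finset.card_singleton, Nat.choose_zero_right]
  | succ j ih =>
    obtain _ | n := n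
    · rw [Nat.choose_zero_succ, Finset.card_eq_zero, Finset.eq_empty_iff_forall_notMem]
      intro z hz
      obtain ⟨-, hzy, hgz⟩ := mem_layer.1 hz
      have := grade_mono (𝕆 := ℕ) hzy
      omega
    have above_atom (p : P) (hp : p ∈ layer x y 1) :
        (layer p y j).card * 1 = 1 * n.choose j := by
      obtain ⟨hxp, hpy, hgp⟩ := mem_layer.1 hp
      rw [mul_one, one_mul, ih (h.mono hxp le_rfl) hpy (n := n) (by omega)]
    have hmul := card_layer_succ_mul_choose (fun z hz => h.card_layer_one_of_mem_layer hz)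
      above_atom
    rw [h.card_layer_one hxy hn] at hmul
    exact Nat.eq_of_mul_eq_mul_left n.succ_pos (by linarith)

theorem eq_of_layer_one_eq_of_rank_three (h : HasBooleanAtomCounts x y) (hxy : x ≤ y)
    (hy : grade ℕ y = grade ℕ x + 3) (he : e ∈ layer x y 2) (he' : e' ∈ layer x y 2)
    (hee' : layer x e 1 = layer x e' 1) : e = e' := by
  classical
  by_contra hne
  obtain ⟨r, hr, hre⟩ : ∃ r ∈ layer x y 1, r ∉ layer x e 1 :=
    Finset.exists_mem_notMem_of_card_lt_card (by
      rw [h.card_layer_one_of_mem_layer he, h.card_layer_one hxy hy]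
      norm_num)
  obtain ⟨hxr, hry, hgr⟩ := mem_layer.1 hr
  have not_above (f : P) (hf : layer x e 1 = layer x f 1) : f ∉ layer r y 1 := fun hrf => by
    rw [hf] at hre
    exact hre (mem_layer_of_le_right hr (mem_layer.1 hrf).1)
  have disjoint_above : Disjoint {e, e'} (layer r y 1) := by
    simp [not_above e rfl, not_above e' hee']
  have four_le : ({e, e'} ∪ layer r y 1).card ≤ (layer x y 2).card := Finset.card_le_card <|
    Finset.union_subset (by simp [Finset.insert_subset_iff, he, he'])
      fun f hf => (mem_layer_trans hr hf :)
  rw [Finset.card_union_of_disjoint disjoint_above, Finset.card_pair hne,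
    (h.mono hxr le_rfl).card_layer_one (n := 2) hry (by omega), h.card_layer hxy hy 2] at four_le
  norm_num [Nat.choose] at four_le

end HasBooleanAtomCounts

theorem injOn_layer_one_of_exists_upper_bound
    (h3 : ∀ z, x ≤ z → z ≤ y → grade ℕ z ≤ grade ℕ x + 3 → HasBooleanAtomCounts x z)
    (hub : ∀ p ∈ layer x y 1, ∀ e ∈ layer p y 1, ∀ e' ∈ layer p y 1, e ≠ e' →
      ∃ f ∈ layer p y 2, e ≤ f ∧ e' ≤ f) :
    Set.InjOn (fun e => layer x e 1) (layer x y 2 : Set P) := by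
  intro e he e' he' (hee' : layer x e 1 = layer x e' 1)
  rw [Finset.mem_coe] at he he'
  by_contra hne
  obtain ⟨hxe, hey, hge⟩ := mem_layer.1 he
  obtain ⟨p, hp⟩ : (layer x e 1).Nonempty := layer_nonempty hxe (by omega)
  have hpe' : p ∈ layer x e' 1 := hee' ▸ hp
  have hpy : p ∈ layer x y 1 := layer_mono_right hey hp
  obtain ⟨f, hf, hef, hef'⟩ := hub p hpy e (mem_layer_of_le hpy he (mem_layer.1 hp).2.1) e'
    (mem_layer_of_le hpy he' (mem_layer.1 hpe').2.1) hne
  obtain ⟨hxf, hfy, hgf⟩ := mem_layer.1 (mem_layer_trans hpy hf)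
  exact hne <| (h3 f hxf hfy hgf.le).eq_of_layer_one_eq_of_rank_three hxf hgf
    (mem_layer_of_le_right he hef) (mem_layer_of_le_right he' hef') hee'

theorem HasBooleanAtomCounts.exists_upper_bound (h : HasBooleanAtomCounts x y) (hxy : x ≤ y)
    (hu : u ∈ layer x y 1) (hv : v ∈ layer x y 1) (huv : u ≠ v) :
    ∃ f ∈ layer x y 2, u ≤ f ∧ v ≤ f := by
  classical
  obtain ⟨n, hn⟩ := Nat.exists_eq_add_of_le (grade_mono (𝕆 := ℕ) hxy)
  induction n generalizing x u v with
  | zero =>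
    obtain ⟨-, huy, hgu⟩ := mem_layer.1 hu
    have := grade_mono (𝕆 := ℕ) huy
    omega
  | succ n ih =>
    have injOn : Set.InjOn (fun e => layer x e 1) (layer x y 2 : Set P) :=
      injOn_layer_one_of_exists_upper_bound (fun z _ hzy _ => h.mono le_rfl hzy)
        fun p hp e he e' he' hne => by
          obtain ⟨hxp, hpy, hgp⟩ := mem_layer.1 hp
          exact ih (h.mono hxp le_rfl) hpy he he' hne (by omega)
    have image_eq : (layer x y 2).image (fun e => layer x e 1) = (layer x y 1).powersetCard 2 := by
      refine Finset.eq_of_subset_of_card_le (Finset.image_subset_iff.2 fun e he => ?_) ?_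
      · exact Finset.mem_powersetCard.2
          ⟨layer_mono_right (mem_layer.1 he).2.1, h.card_layer_one_of_mem_layer he⟩
      · rw [Finset.card_powersetCard, Finset.card_image_of_injOn injOn, h.card_layer_one hxy hn,
          h.card_layer hxy hn]
    have huv_mem : {u, v} ∈ (layer x y 1).powersetCard 2 :=
      Finset.mem_powersetCard.2 ⟨by simp [Finset.insert_subset_iff, hu, hv], Finset.card_pair huv⟩
    rw [← image_eq, Finset.mem_image] at huv_mem
    obtain ⟨f, hf, hfuv⟩ := huv_mem
    have below_f (q : P) (hq : q ∈ ({u, v} : Finset P)) : q ≤ f :=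
      (mem_layer.1 (hfuv ▸ hq : q ∈ layer x f 1)).2.1
    exact ⟨f, hf, below_f u (by simp), below_f v (by simp)⟩

theorem injOn_layer_one
    (h3 : ∀ z, x ≤ z → z ≤ y → grade ℕ z ≤ grade ℕ x + 3 → HasBooleanAtomCounts x z)
    (hatoms : ∀ p ∈ layer x y 1, HasBooleanAtomCounts p y) :
    Set.InjOn (fun e => layer x e 1) (layer x y 2 : Set P) :=
  injOn_layer_one_of_exists_upper_bound h3 fun p hp _ he _ he' =>
    (hatoms p hp).exists_upper_bound (mem_layer.1 hp).2.1 he he'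

theorem lt_card_layer_one (hxy : x ≤ y) (hn : grade ℕ y = grade ℕ x + (n + 1))
    (h3 : ∀ z, x ≤ z → z ≤ y → grade ℕ z ≤ grade ℕ x + 3 → HasBooleanAtomCounts x z)
    (hatoms : ∀ p ∈ layer x y 1, HasBooleanAtomCounts p y) : n < (layer x y 1).card := by
  classical
  have card_two (e : P) (he : e ∈ layer x y 2) : (layer x e 1).card = 2 := by
    obtain ⟨hxe, hey, hge⟩ := mem_layer.1 he
    exact (h3 e hxe hey (by omega)).card_layer_one hxe hge
  have double_count : (layer x y 2).card * (2 * 1) = (layer x y 1).card * n :=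
    card_layer_succ_mul card_two fun p hp => by
      obtain ⟨-, hpy, hgp⟩ := mem_layer.1 hp
      rw [mul_one, (hatoms p hp).card_layer_one (n := n) hpy (by omega)]
  have card_le_choose : (layer x y 2).card ≤ (layer x y 1).card.choose 2 := by
    rw [← Finset.card_powersetCard, ← Finset.card_image_of_injOn (injOn_layer_one h3 hatoms)]
    exact Finset.card_le_card <| Finset.image_subset_iff.2 fun e he =>
      Finset.mem_powersetCard.2 ⟨layer_mono_right (mem_layer.1 he).2.1, card_two e he⟩
  have card_pos : 0 < (layer x y 1).card := Finset.card_pos.2 (layer_nonempty hxy (by omega))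
  have : (layer x y 1).card * n ≤ (layer x y 1).card * ((layer x y 1).card - 1) := by
    calc (layer x y 1).card * n = (layer x y 2).card * 2 := double_count.symm
      _ ≤ (layer x y 1).card.choose 2 * 2 := Nat.mul_le_mul_right 2 card_le_choose
      _ ≤ _ := by rw [Nat.choose_two_right]; exact Nat.div_mul_le_self _ _
  have := Nat.le_of_mul_le_mul_left this card_pos
  omega

namespace HasBooleanAtomCounts

theorem le_of_layer_one_subset (h : HasBooleanAtomCounts x y) (hxz : x ≤ z) (hzy : z ≤ y)
    (hxw : x ≤ w) (hwy : w ≤ y) (hzw : layer x z 1 ⊆ layer x w 1) : z ≤ w := by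
  classical
  obtain ⟨n, hn⟩ := Nat.exists_eq_add_of_le (grade_mono (𝕆 := ℕ) hxz)
  induction n generalizing x with
  | zero => exact eq_of_le_of_grade_le hxz hn.le ▸ hxw
  | succ n ih =>
    obtain ⟨p, hp⟩ : (layer x z 1).Nonempty := layer_nonempty hxz (by omega)
    obtain ⟨hxp, hpz, hgp⟩ := mem_layer.1 hp
    have hpw : p ≤ w := (mem_layer.1 (hzw hp)).2.1
    refine ih (h.mono hxp le_rfl) hpz hpw (fun e he => ?_) (by omega)
    have hez : e ∈ layer x z 2 := (mem_layer_trans hp he :)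
    have card_two (f : P) (hf : f ∈ layer x y 2) : (layer x f 1).card = 2 :=
      h.card_layer_one_of_mem_layer hf
    have he_card := card_two e (layer_mono_right hzy hez)
    obtain ⟨u, v, huv, hatoms⟩ := Finset.card_eq_two.1 he_card
    have hatoms_w : {u, v} ⊆ layer x w 1 :=
      hatoms ▸ (layer_mono_right (mem_layer.1 hez).2.1).trans hzw
    rw [Finset.insert_subset_iff, Finset.singleton_subset_iff] at hatoms_w
    obtain ⟨f, hf, huf, hvf⟩ :=
      (h.mono le_rfl hwy).exists_upper_bound hxw hatoms_w.1 hatoms_w.2 huv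
    have hf_card := card_two f (layer_mono_right hwy hf)
    have hef : layer x e 1 = layer x f 1 := by
      refine Finset.eq_of_subset_of_card_le ?_ (hf_card.trans he_card.symm).le
      rw [hatoms, Finset.insert_subset_iff, Finset.singleton_subset_iff]
      exact ⟨mem_layer_of_le_right hatoms_w.1 huf, mem_layer_of_le_right hatoms_w.2 hvf⟩
    obtain rfl : e = f := injOn_layer_one (fun q _ hqy _ => h.mono le_rfl hqy)
      (fun q hq => h.mono (mem_layer.1 hq).1 le_rfl) (layer_mono_right hzy hez)
      (layer_mono_right hwy hf) hef
    exact mem_layer_of_le (hzw hp) hf (mem_layer.1 he).1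

theorem card_Icc (h : HasBooleanAtomCounts x y) (hxy : x ≤ y) (hn : grade ℕ y = grade ℕ x + n) :
    Nat.card (Set.Icc x y) = 2 ^ n := by
  rw [Nat.card_coe_set_eq, Set.ncard_eq_toFinset_card _ (Set.toFinite _), Finset.card_eq_sum_ones,
    sum_Icc_eq_sum_layer _ hn, ← Nat.sum_range_choose]
  exact Finset.sum_congr rfl fun j _ => by rw [← Finset.card_eq_sum_ones, h.card_layer hxy hn]

theorem nonempty_orderIso_finset (h : HasBooleanAtomCounts x y) (hxy : x ≤ y)
    (hn : grade ℕ y = grade ℕ x + n) : Nonempty (Set.Icc x y ≃o Finset (Fin n)) := by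
  classical
  let ε : layer x y 1 ≃ Fin n := Finset.equivFinOfCardEq (h.card_layer_one hxy hn)
  let f : Set.Icc x y → Finset (Fin n) := fun z => {i | (ε.symm i : P) ≤ z}
  have hf (z w : Set.Icc x y) : f z ≤ f w ↔ z ≤ w := by
    refine ⟨fun hzw => h.le_of_layer_one_subset z.2.1 z.2.2 w.2.1 w.2.2 fun p hp => ?_,
      fun hzw => Finset.monotone_filter_right _ fun _ _ hi => le_trans hi hzw⟩
    have hpy : p ∈ layer x y 1 := layer_mono_right z.2.2 hp
    have hpz : ε ⟨p, hpy⟩ ∈ f z := by simpa [f] using (mem_layer.1 hp).2.1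
    exact mem_layer_of_le_right hpy (by simpa [f] using hzw hpz)
  let F := OrderEmbedding.ofMapLEIff f hf
  have hbij : Function.Bijective F := (Nat.bijective_iff_injective_and_card F).2
    ⟨F.injective, by rw [h.card_Icc hxy hn]; simp⟩
  exact ⟨RelIso.ofSurjective F hbij.surjective⟩

end HasBooleanAtomCounts

end BooleanIntervals

section EulerianRelations

theorem alternating_ends_eq {R : Type*} [CommRing R] {l : ℕ} (hl : Odd l) {f g : ℕ → R}
    (hfg : ∀ i < l, f (i + 2) = g (i + 2))
    (hf : ∑ j ∈ Finset.range (l + 4), (-1) ^ j * f j = 0)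
    (hg : ∑ j ∈ Finset.range (l + 4), (-1) ^ j * g j = 0) :
    f 0 - f 1 - f (l + 2) + f (l + 3) = g 0 - g 1 - g (l + 2) + g (l + 3) := by
  have hmid : ∑ i ∈ Finset.range l, (-1) ^ (i + 1 + 1) * f (i + 1 + 1) =
      ∑ i ∈ Finset.range l, (-1) ^ (i + 1 + 1) * g (i + 1 + 1) :=
    Finset.sum_congr rfl fun i hi => by rw [hfg i (Finset.mem_range.1 hi)]
  rw [Finset.sum_range_succ, Finset.sum_range_succ, Finset.sum_range_succ',
    Finset.sum_range_succ'] at hf hg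
  rw [hmid] at hf
  have h2 : (-1 : R) ^ (l + 2) = -1 := by simp [pow_add, hl.neg_one_pow]
  have h3 : (-1 : R) ^ (l + 3) = 1 := by rw [pow_succ, h2]; ring
  rw [h2, h3] at hf hg
  linear_combination hf - hg

theorem card_layer_succ_mul_of_hasBooleanAtomCounts {P : Type*} [Finite P] [PartialOrder P]
    [GradeOrder ℕ P] {x y : P} {j n : ℕ} (hn : grade ℕ y = grade ℕ x + (n + 1))
    (hbool : ∀ u v, x ≤ u → v ≤ y → grade ℕ v ≤ grade ℕ u + n → HasBooleanAtomCounts u v)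
    (hj : j < n) :
    (layer x y (j + 1)).card * (n + 1) = (layer x y 1).card * (n + 1).choose (j + 1) := by
  have h := card_layer_succ_mul_choose (x := x) (y := y) (n := n) (j := j) (M := 1) (w := 1)
    (fun z hz => ?_) fun p hp => ?_
  · rwa [mul_one, mul_one] at h
  · obtain ⟨hxz, hzy, hgz⟩ := mem_layer.1 hz
    exact (hbool x z le_rfl hzy (by omega)).card_layer_one hxz hgz
  · obtain ⟨hxp, hpy, hgp⟩ := mem_layer.1 hp
    rw [(hbool p y hxp le_rfl (by omega)).card_layer (n := n) hpy (by omega), mul_comm]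

theorem card_layer_add_two_eq_card_layer_one {P : Type*} [Finite P] [PartialOrder P]
    [GradeOrder ℕ P] {x y : P} {n a : ℕ} (hxy : x ≤ y) (hy : grade ℕ y = grade ℕ x + (n + 3))
    (hbool : ∀ u v, x ≤ u → v ≤ y → grade ℕ v ≤ grade ℕ u + (n + 1) → HasBooleanAtomCounts u v)
    (ha : ∀ u v, x ≤ u → u ≤ v → v ≤ y → grade ℕ v = grade ℕ u + (n + 2) →
      (layer u v 1).card = a) :
    (layer x y (n + 2)).card = (layer x y 1).card := by
  have above_atom (p : P) (hp : p ∈ layer x y 1) :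
      (layer p y (n + 1)).card * (n + 2) = a * (n + 2) := by
    obtain ⟨hxp, hpy, hgp⟩ := mem_layer.1 hp
    rw [← ha p y hxp hpy le_rfl (by omega), card_layer_succ_mul_of_hasBooleanAtomCounts
      (n := n + 1) (by omega) (fun u v hu hv => hbool u v (hxp.trans hu) hv) (by omega)]
    congr 1
    exact Nat.choose_succ_self_right (n + 1)
  have h := card_layer_succ_mul (x := x) (y := y) (j := n + 1) (c := a) (M := n + 2)
    (fun z hz => ha x z le_rfl (mem_layer.1 hz).1 (mem_layer.1 hz).2.1 (mem_layer.1 hz).2.2)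
    above_atom
  obtain ⟨p, hp⟩ : (layer x y 1).Nonempty := layer_nonempty hxy (by omega)
  obtain ⟨hxp, hpy, hgp⟩ := mem_layer.1 hp
  have a_pos : 0 < a := ha p y hxp hpy le_rfl (by omega) ▸
    Finset.card_pos.2 (layer_nonempty hpy (by omega))
  exact Nat.eq_of_mul_eq_mul_right (by positivity) h

variable {P : Type*} [Finite P] [PartialOrder P] [GradeMinOrder ℕ P]
  {x y : P} {l n a b : ℕ}

namespace IsEulerian

theorem sum_card_layer (hE : IsEulerian P) (hxy : x < y) (hn : grade ℕ y = grade ℕ x + n) :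
    ∑ j ∈ Finset.range (n + 1), (-1 : ℤ) ^ j * (layer x y j).card = 0 := by
  classical
  have sum_Icc : ∑ z ∈ (Set.toFinite (Set.Icc x y)).toFinset, (-1 : ℤ) ^ grade ℕ z = 0 := by
    have card_eq := hE x y hxy
    have ncard_eq (q : ℕ → Prop) [DecidablePred q] : {z ∈ Set.Icc x y | q (grade ℕ z)}.ncard =
        ((Set.toFinite (Set.Icc x y)).toFinset.filter fun z => q (grade ℕ z)).card := by
      rw [← Set.ncard_coe_finset]
      simp [Set.ofPred_and]
    rw [ncard_eq, ncard_eq] at card_eq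
    rw [← Finset.sum_filter_add_sum_filter_not _ fun z => Even (grade ℕ z),
      Finset.sum_congr rfl fun z hz => (Finset.mem_filter.1 hz).2.neg_one_pow,
      Finset.sum_congr rfl fun z hz =>
        (Nat.not_even_iff_odd.1 (Finset.mem_filter.1 hz).2).neg_one_pow]
    simp [card_eq]
  have sum_layer (j : ℕ) : ∑ z ∈ layer x y j, (-1 : ℤ) ^ grade ℕ z =
      (-1) ^ grade ℕ x * ((-1) ^ j * (layer x y j).card) := by
    rw [Finset.sum_congr rfl fun z hz => by rw [(mem_layer.1 hz).2.2], Finset.sum_const,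
      nsmul_eq_mul, pow_add]
    ring
  rw [sum_Icc_eq_sum_layer _ hn, Finset.sum_congr rfl fun j _ => sum_layer j,
    ← Finset.mul_sum] at sum_Icc
  exact (mul_eq_zero.1 sum_Icc).resolve_left (by simp)

theorem card_layer_one_of_rank_two (hE : IsEulerian P) (hxy : x ≤ y)
    (hy : grade ℕ y = grade ℕ x + 2) : (layer x y 1).card = 2 := by
  have h := hE.sum_card_layer (hxy.lt_of_ne (by rintro rfl; omega)) hy
  simp only [Finset.sum_range_succ, Finset.sum_range_zero, layer_zero hxy, layer_top hxy hy,
    Finset.card_singleton] at h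
  omega

theorem mul_card_layer_ends (hE : IsEulerian P) (hl : Odd l) (hxy : x ≤ y)
    (hy : grade ℕ y = grade ℕ x + (l + 3)) {K : ℤ} {g : ℕ → ℤ}
    (hg : ∑ j ∈ Finset.range (l + 4), (-1) ^ j * g j = 0)
    (hmid : ∀ i < l, K * (layer x y (i + 2)).card = g (i + 2)) :
    K * (2 - (layer x y 1).card - (layer x y (l + 2)).card) =
      g 0 - g 1 - g (l + 2) + g (l + 3) := by
  have hsum := hE.sum_card_layer (hxy.lt_of_ne (by rintro rfl; omega)) hy
  have h := alternating_ends_eq hl (f := fun j => K * (layer x y j).card) hmid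
    (by simp only [mul_left_comm _ K, ← Finset.mul_sum, hsum, mul_zero]) hg
  rw [← h, layer_zero hxy, layer_top hxy hy]
  simp only [Finset.card_singleton]
  push_cast
  ring

theorem card_layer_one_mul_of_even_rank (hE : IsEulerian P) (hl : Odd l) (hxy : x ≤ y)
    (hy : grade ℕ y = grade ℕ x + (l + 3))
    (hbool : ∀ u v, x ≤ u → v ≤ y → grade ℕ v ≤ grade ℕ u + (l + 1) → HasBooleanAtomCounts u v)
    (ha : ∀ u v, x ≤ u → u ≤ v → v ≤ y → grade ℕ v = grade ℕ u + (l + 2) →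
      (layer u v 1).card = a) :
    (layer x y 1).card * a + (l + 3) = (layer x y 1).card * (l + 3) := by
  have above_atom (p : P) (hp : p ∈ layer x y 1) (i : ℕ) (hi : i < l) :
      (layer p y (i + 1)).card * (l + 2) = a * (l + 2).choose (i + 1) := by
    obtain ⟨hxp, hpy, hgp⟩ := mem_layer.1 hp
    rw [← ha p y hxp hpy le_rfl (by omega)]
    exact card_layer_succ_mul_of_hasBooleanAtomCounts (n := l + 1) (by omega)
      (fun u v hu hv => hbool u v (hxp.trans hu) hv) (by omega)
  have middle (i : ℕ) (hi : i < l) : (layer x y (i + 2)).card * ((l + 3) * (l + 2)) =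
      (layer x y 1).card * a * (l + 3).choose (i + 2) :=
    card_layer_succ_mul_choose (j := i + 1) (n := l + 2) (fun z hz => by
      obtain ⟨hxz, hzy, hgz⟩ := mem_layer.1 hz
      exact (hbool x z le_rfl hzy (by omega)).card_layer_one hxz hgz)
      fun p hp => above_atom p hp i hi
  have coatoms := card_layer_add_two_eq_card_layer_one hxy hy hbool ha
  have ends := hE.mul_card_layer_ends hl hxy hy (K := (l + 3) * (l + 2))
    (g := fun j => (layer x y 1).card * a * (l + 3).choose j)
    (by
      simp only [mul_left_comm _ ((layer x y 1).card * a : ℤ), ← Finset.mul_sum,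
        Int.alternating_sum_range_choose_of_ne (show l + 3 ≠ 0 by omega), mul_zero])
    (fun i hi => by rw [mul_comm]; exact_mod_cast middle i hi)
  simp only [coatoms, Nat.choose_zero_right, Nat.choose_one_right, Nat.choose_self,
    show (l + 3).choose (l + 2) = l + 3 from Nat.choose_succ_self_right (l + 2)] at ends
  push_cast at ends
  have cancelled : ((layer x y 1).card * a + (l + 3) : ℤ) = (layer x y 1).card * (l + 3) :=
    mul_left_cancel₀ (by positivity : (2 * (l + 2) : ℤ) ≠ 0) (by linear_combination ends)
  exact_mod_cast cancelled

theorem mul_card_layer_one_of_even_rank (hE : IsEulerian P) (hl : Odd l) (hxy : x ≤ y)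
    (hy : grade ℕ y = grade ℕ x + (l + 3))
    (hatoms : ∀ p ∈ layer x y 1, HasBooleanAtomCounts p y)
    (htwo : ∀ i < l, ∀ z ∈ layer x y (i + 2), (layer x z 1).card = 2)
    (hb : ∀ z ∈ layer x y (l + 2), (layer x z 1).card = b) :
    b * ((layer x y 1).card * l + 4) = 2 * ((layer x y 1).card * (l + 2)) := by
  have above_atom (p : P) (hp : p ∈ layer x y 1) (j : ℕ) :
      (layer p y j).card * 1 = (l + 2).choose j := by
    obtain ⟨-, hpy, hgp⟩ := mem_layer.1 hp
    rw [(hatoms p hp).card_layer (n := l + 2) hpy (by omega), mul_one]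
  have middle (i : ℕ) (hi : i < l) :
      (layer x y (i + 2)).card * 2 = (layer x y 1).card * (l + 2).choose (i + 1) := by
    simpa using card_layer_succ_mul (htwo i hi) fun p hp => above_atom p hp (i + 1)
  have coatoms : (layer x y (l + 2)).card * b = (layer x y 1).card * (l + 2) := by
    simpa [Nat.choose_succ_self_right] using
      card_layer_succ_mul hb fun p hp => above_atom p hp (l + 1)
  have sum_choose : ∑ j ∈ Finset.range (l + 4), (-1 : ℤ) ^ j * (l + 2).choose j = 0 := by
    rw [Finset.sum_range_succ, Nat.choose_succ_self,
      Int.alternating_sum_range_choose_of_ne (show l + 2 ≠ 0 by omega)]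
    simp
  -- Pascal: the comparison sequence at `j + 1` is `(layer x y 1).card * (l + 2).choose j`.
  have ends := hE.mul_card_layer_ends hl hxy hy (K := 2)
    (g := fun j => (layer x y 1).card * ((l + 3).choose j - (l + 2).choose j))
    (by
      simp only [mul_left_comm _ ((layer x y 1).card : ℤ), ← Finset.mul_sum, mul_sub,
        Finset.sum_sub_distrib, sum_choose,
        Int.alternating_sum_range_choose_of_ne (show l + 3 ≠ 0 by omega), mul_zero, sub_zero])
    (fun i hi => by
      have pascal := Nat.choose_succ_succ (l + 2) (i + 1)
      have := middle i hi
      zify at pascal this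
      linear_combination this - ((layer x y 1).card : ℤ) * pascal)
  simp only [Nat.choose_zero_right, Nat.choose_one_right, Nat.choose_self, Nat.choose_succ_self,
    show (l + 3).choose (l + 2) = l + 3 from Nat.choose_succ_self_right (l + 2)] at ends
  push_cast at ends
  zify at coatoms ⊢
  linear_combination (b : ℤ) * ends + 2 * coatoms

end IsEulerian

end EulerianRelations

section AtomPairs

theorem exists_equiv_prod_of_card_fiber {α β : Type*} [Finite α] {n : ℕ} (g : α → β)
    (h : ∀ a, Nat.card {b // g b = g a} = n) :
    ∃ (k : ℕ) (e : Fin k × Fin n ≃ α), ∀ u v, g (e u) = g (e v) ↔ u.1 = v.1 := by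
  let r : α → Set.range g := Set.rangeFactorization g
  let ε : Set.range g ≃ Fin (Nat.card (Set.range g)) := Finite.equivFin _
  have card_fiber (b : Set.range g) : Nat.card {a // r a = b} = n := by
    obtain ⟨_, a, rfl⟩ := b
    rw [← h a]
    exact Nat.card_congr (Equiv.subtypeEquivRight fun a' =>
      Set.rangeFactorization_eq_rangeFactorization_iff a' a)
  let φ (b : Set.range g) : Fin n ≃ {a // r a = b} :=
    (finCongr (card_fiber b).symm).trans (Finite.equivFin _).symm
  let e : Fin (Nat.card (Set.range g)) × Fin n ≃ α :=
    (Equiv.prodCongrLeft fun _ => ε.symm).trans <| (Equiv.sigmaEquivProd _ _).symm.trans <|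
      (Equiv.sigmaCongrRight φ).trans (Equiv.sigmaFiberEquiv r)
  have map_e (u) : r (e u) = ε.symm u.1 := (φ (ε.symm u.1) u.2).2
  refine ⟨_, e, fun u v => ?_⟩
  rw [← ε.symm.injective.eq_iff, ← map_e, ← map_e]
  exact (Set.rangeFactorization_eq_rangeFactorization_iff _ _).symm

variable {P : Type*} [Finite P] [PartialOrder P] [GradeOrder ℕ P] {x y p e e' : P}

theorem layer_one_eq_of_card_le (hee' : e ≤ e')
    (hcard : (layer x e' 1).card ≤ (layer x e 1).card) : layer x e 1 = layer x e' 1 :=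
  Finset.eq_of_subset_of_card_le (layer_mono_right hee') hcard

theorem layer_one_eq_of_common_atom (h3 : ∀ z ∈ layer x y 3, (layer x z 1).card = 2)
    (h2 : ∀ z ∈ layer x y 2, (layer x z 1).card = 2) (hp : p ∈ layer x y 1)
    (hbool : HasBooleanAtomCounts p y) (he : e ∈ layer p y 1) (he' : e' ∈ layer p y 1) :
    layer x e 1 = layer x e' 1 := by
  by_cases hee' : e = e'
  · rw [hee']
  obtain ⟨f, hf, hef, hef'⟩ := hbool.exists_upper_bound (mem_layer.1 hp).2.1 he he' hee'
  have eq_layer_f (c : P) (hc : c ∈ layer p y 1) (hcf : c ≤ f) : layer x c 1 = layer x f 1 :=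
    layer_one_eq_of_card_le hcf <| by
      rw [h3 f (mem_layer_trans hp hf :), h2 c (mem_layer_trans hp hc :)]
  rw [eq_layer_f e he hef, eq_layer_f e' he' hef']

theorem exists_atom_pairing (hxy : grade ℕ x + 2 ≤ grade ℕ y)
    (h3 : ∀ z ∈ layer x y 3, (layer x z 1).card = 2)
    (h2 : ∀ z ∈ layer x y 2, (layer x z 1).card = 2)
    (hbool : ∀ p ∈ layer x y 1, HasBooleanAtomCounts p y) :
    ∃ (k : ℕ) (a : Fin k × Fin 2 ≃ layer x y 1),
      ∀ u v, ∀ e ∈ layer (a u : P) y 1, (a v : P) ≤ e ↔ u.1 = v.1 := by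
  have exists_cover (p : layer x y 1) : (layer (p : P) y 1).Nonempty := by
    have hp := mem_layer.1 p.2
    exact layer_nonempty hp.2.1 (by omega)
  choose c hc using exists_cover
  have twins (p : layer x y 1) {e : P} (he : e ∈ layer (p : P) y 1) :
      layer x e 1 = layer x (c p) 1 :=
    layer_one_eq_of_common_atom h3 h2 p.2 (hbool p p.2) he (hc p)
  have mem_iff (p q : layer x y 1) :
      layer x (c q) 1 = layer x (c p) 1 ↔ (q : P) ∈ layer x (c p) 1 := by
    refine ⟨fun h => h ▸ mem_layer_of_le_right q.2 (mem_layer.1 (hc q)).1, fun h => ?_⟩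
    have hcp : c p ∈ layer x y (1 + 1) := mem_layer_trans p.2 (hc p)
    exact (twins q (mem_layer_of_le q.2 hcp (mem_layer.1 h).2.1)).symm
  have card_fiber (p : layer x y 1) :
      Nat.card {q : layer x y 1 // layer x (c q) 1 = layer x (c p) 1} = 2 := by
    have hcp : c p ∈ layer x y 2 := (mem_layer_trans p.2 (hc p) :)
    rw [← h2 _ hcp, ← Nat.card_eq_finsetCard]
    exact Nat.card_congr <| (Equiv.subtypeEquivRight (mem_iff p)).trans <|
      Equiv.subtypeSubtypeEquivSubtype fun hq => layer_mono_right (mem_layer.1 hcp).2.1 hq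
  obtain ⟨k, a, ha⟩ := exists_equiv_prod_of_card_fiber (fun q => layer x (c q) 1) card_fiber
  refine ⟨k, a, fun u v e he => ?_⟩
  rw [eq_comm, ← ha, mem_iff, ← twins (a u) he]
  exact ⟨mem_layer_of_le_right (a v).2, fun h => (mem_layer.1 h).2.1⟩

theorem even_card_layer_one (hxy : grade ℕ x + 2 ≤ grade ℕ y)
    (h3 : ∀ z ∈ layer x y 3, (layer x z 1).card = 2)
    (h2 : ∀ z ∈ layer x y 2, (layer x z 1).card = 2)
    (hbool : ∀ p ∈ layer x y 1, HasBooleanAtomCounts p y) : Even (layer x y 1).card := by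
  obtain ⟨k, a, -⟩ := exists_atom_pairing hxy h3 h2 hbool
  have := Nat.card_congr a
  simp only [Nat.card_prod, Nat.card_fin, Nat.card_eq_finsetCard] at this
  exact ⟨k, by omega⟩

end AtomPairs

section ShefferPosets

theorem numMaxChains_of_covBy {P : Type*} [Finite P] [PartialOrder P] [GradeOrder ℕ P] {x y : P}
    (h : x ⋖ y) : numMaxChains x y = 1 := by
  have layer_one : layer x y 1 = {y} :=
    layer_top h.le (Nat.covBy_iff_add_one_eq.1 (h.grade ℕ)).symm
  rw [numMaxChains_eq_sum h.lt, layer_one, Finset.sum_singleton, numMaxChains_self]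

namespace IsEulerian

variable {P : Type*} [Finite P] [PartialOrder P] [GradeMinOrder ℕ P] {x y : P}

theorem numMaxChains_of_rank_two (hE : IsEulerian P) (hxy : x ≤ y)
    (hy : grade ℕ y = grade ℕ x + 2) : numMaxChains x y = 2 := by
  rw [numMaxChains_eq_card_mul (hxy.lt_of_ne (by rintro rfl; omega)) fun p hp => ?_,
    hE.card_layer_one_of_rank_two hxy hy, mul_one]
  obtain ⟨-, hpy, hgp⟩ := mem_layer.1 hp
  exact numMaxChains_of_covBy (mem_layer_one_iff_covBy.1 (layer_top (n := 1) hpy (by omega) ▸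
    Finset.mem_singleton_self y : y ∈ layer p y 1)).1

theorem numMaxChains_of_rank_three (hE : IsEulerian P) (hxy : x ≤ y)
    (hy : grade ℕ y = grade ℕ x + 3) : numMaxChains x y = (layer x y 1).card * 2 :=
  numMaxChains_eq_card_mul (hxy.lt_of_ne (by rintro rfl; omega)) fun p hp => by
    obtain ⟨-, hpy, hgp⟩ := mem_layer.1 hp
    exact hE.numMaxChains_of_rank_two hpy (by omega)

theorem hasBooleanAtomCounts_of_rank_le_two (hE : IsEulerian P)
    (hy : grade ℕ y ≤ grade ℕ x + 2) : HasBooleanAtomCounts x y := by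
  intro u v hu huv hv
  have := grade_mono (𝕆 := ℕ) hu
  have := grade_mono (𝕆 := ℕ) hv
  obtain ⟨n, hn⟩ := Nat.exists_eq_add_of_le (grade_mono (𝕆 := ℕ) huv)
  suffices (layer u v 1).card = n by omega
  have hn2 : n ≤ 2 := by omega
  interval_cases n
  · obtain rfl := eq_of_le_of_grade_le huv hn.le
    refine Finset.card_eq_zero.2 (Finset.eq_empty_of_forall_notMem fun p hp => ?_)
    have hp := mem_layer_one_iff_covBy.1 hp
    exact hp.1.lt.not_ge hp.2
  · rw [layer_top huv hn, Finset.card_singleton]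
  · exact hE.card_layer_one_of_rank_two huv hn

end IsEulerian

theorem eq_two_of_mul_eq_two_mul {A b l : ℕ} (hl : 2 ≤ l) (hb : Even b) (hb_pos : 0 < b)
    (h : b * (A * l + 4) = 2 * (A * (l + 2))) : b = 2 := by
  obtain ⟨c, rfl⟩ := hb
  have c_lt : c < 2 := by
    by_contra! hc
    nlinarith [Nat.mul_le_mul_left A hl, Nat.mul_le_mul_right (A * l + 4) hc]
  omega

variable {P : Type*} [Finite P] [PartialOrder P] [BoundedOrder P] [GradeMinOrder ℕ P]
  {x y u v : P} {l n m : ℕ}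

namespace IsSheffer

theorem card_layer_one_eq (hS : IsSheffer P) (hx : x ≠ ⊥) (hu : u ≠ ⊥) (hxy : x ≤ y) (huv : u ≤ v)
    (hy : grade ℕ y = grade ℕ x + (n + 1)) (hv : grade ℕ v = grade ℕ u + (n + 1)) :
    (layer x y 1).card = (layer u v 1).card := by
  refine card_layer_one_eq_of_numMaxChains_eq (hxy.lt_of_ne (by rintro rfl; omega))
    (huv.lt_of_ne (by rintro rfl; omega)) (hS.binomial_interval _ x y u v hx hu hxy huv hy hv) ?_
  intro p hp q hq
  obtain ⟨hxp, hpy, hgp⟩ := mem_layer.1 hp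
  obtain ⟨huq, hqv, hgq⟩ := mem_layer.1 hq
  exact hS.binomial_interval n p y q v (ne_bot_of_le_ne_bot hx hxp) (ne_bot_of_le_ne_bot hu huq)
    hpy hqv (by omega) (by omega)

theorem card_atoms_eq (hS : IsSheffer P) (hy : grade ℕ y = n + 1) (hv : grade ℕ v = n + 1) :
    (layer ⊥ y 1).card = (layer ⊥ v 1).card := by
  have grade_bot : grade ℕ (⊥ : P) = 0 := grade_bot
  refine card_layer_one_eq_of_numMaxChains_eq (bot_lt_iff_ne_bot.2 (by rintro rfl; omega))
    (bot_lt_iff_ne_bot.2 (by rintro rfl; omega)) (hS.sheffer_interval _ y v hy hv) ?_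
  intro p hp q hq
  obtain ⟨hp_covBy, hpy⟩ := mem_layer_one_iff_covBy.1 hp
  obtain ⟨hq_covBy, hqv⟩ := mem_layer_one_iff_covBy.1 hq
  have hgp := (mem_layer.1 hp).2.2
  have hgq := (mem_layer.1 hq).2.2
  exact hS.binomial_interval n p y q v hp_covBy.lt.ne' hq_covBy.lt.ne' hpy hqv (by omega) (by omega)

theorem hasBooleanAtomCounts_of_rank_le_succ (hS : IsSheffer P)
    (hbool : ∀ u v : P, u ≠ ⊥ → grade ℕ v ≤ grade ℕ u + n → HasBooleanAtomCounts u v)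
    (hx : x ≠ ⊥) (hxy : x ≤ y) (hy : grade ℕ y = grade ℕ x + (n + 1))
    (hcard : (layer x y 1).card = n + 1) (hu : u ≠ ⊥) (hv : grade ℕ v ≤ grade ℕ u + (n + 1)) :
    HasBooleanAtomCounts u v := by
  intro s t hs hst ht
  have hs_bot : s ≠ ⊥ := ne_bot_of_le_ne_bot hu hs
  have := grade_mono (𝕆 := ℕ) hs
  have := grade_mono (𝕆 := ℕ) ht
  rcases Nat.lt_or_ge (grade ℕ s + n) (grade ℕ t) with hlt | hle
  · have hgt : grade ℕ t = grade ℕ s + (n + 1) := by omega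
    rw [hS.card_layer_one_eq hs_bot hx hst hxy hgt hy, hcard, hgt]
  · exact hbool s t hs_bot hle s t le_rfl hst le_rfl

end IsSheffer

namespace IsEulerian

theorem hasBooleanAtomCounts_of_rank_le_add_three (hE : IsEulerian P) (hS : IsSheffer P)
    (h3 : ∀ u v : P, u ≠ ⊥ → u ≤ v → grade ℕ v = grade ℕ u + 3 → (layer u v 1).card = 3)
    (hl : Odd l)
    (hbool : ∀ u v : P, u ≠ ⊥ → grade ℕ v ≤ grade ℕ u + (l + 1) → HasBooleanAtomCounts u v)
    (hx : x ≠ ⊥) (hxy : x ≤ y) (hy : grade ℕ y = grade ℕ x + (l + 3)) (hu : u ≠ ⊥)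
    (hv : grade ℕ v ≤ grade ℕ u + (l + 3)) : HasBooleanAtomCounts u v := by
  obtain ⟨w, hw⟩ : (layer x y (l + 2)).Nonempty := layer_nonempty hxy (by omega)
  obtain ⟨hxw, -, hgw⟩ := mem_layer.1 hw
  have relation := hE.card_layer_one_mul_of_even_rank hl hxy hy
    (fun u v hu _ => hbool u v (ne_bot_of_le_ne_bot hx hu)) (a := (layer x w 1).card)
    fun u v hu huv _ hgv =>
      hS.card_layer_one_eq (ne_bot_of_le_ne_bot hx hu) hx huv hxw hgv hgw
  have lower_bound : l + 2 ≤ (layer x w 1).card := by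
    obtain rfl | hl1 := eq_or_ne l 1
    · rw [h3 x w hx hxw hgw]
    have two_le : 2 ≤ l := by
      have := hl.pos
      omega
    refine lt_card_layer_one hxw (n := l + 1) hgw (fun z _ _ hz => hbool x z hx (by omega)) ?_
    intro p hp
    obtain ⟨hxp, -, hgp⟩ := mem_layer.1 hp
    exact hbool p w (ne_bot_of_le_ne_bot hx hxp) (by omega)
  have upper_bound : (layer x w 1).card < l + 3 :=
    Nat.lt_of_mul_lt_mul_left (a := (layer x y 1).card) (by omega)
  have card_xw : (layer x w 1).card = l + 2 := by omega
  have card_xy : (layer x y 1).card = l + 3 := by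
    rw [card_xw] at relation
    linarith
  exact hS.hasBooleanAtomCounts_of_rank_le_succ (n := l + 2)
    (fun u v hu => hS.hasBooleanAtomCounts_of_rank_le_succ hbool hx hxw hgw card_xw hu)
    hx hxy hy card_xy hu hv

theorem hasBooleanAtomCounts (hE : IsEulerian P) (hS : IsSheffer P)
    (h3 : ∀ u v : P, u ≠ ⊥ → u ≤ v → grade ℕ v = grade ℕ u + 3 → (layer u v 1).card = 3)
    (htop : grade ℕ (⊤ : P) = 2 * m + 1) (hx : x ≠ ⊥) : HasBooleanAtomCounts x ⊤ := by
  have grade_bot : grade ℕ (⊥ : P) = 0 := grade_bot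
  have rank_le (k : ℕ) (hk : k < m) :
      ∀ u v : P, u ≠ ⊥ → grade ℕ v ≤ grade ℕ u + 2 * (k + 1) → HasBooleanAtomCounts u v := by
    induction k with
    | zero => exact fun u v _ hv => hE.hasBooleanAtomCounts_of_rank_le_two hv
    | succ k ih =>
      intro u v hu hv
      obtain ⟨w, hw⟩ : (layer (⊥ : P) ⊤ (2 * m + 1 - 2 * (k + 2))).Nonempty :=
        layer_nonempty le_top (by omega)
      have hgw := (mem_layer.1 hw).2.2
      exact hE.hasBooleanAtomCounts_of_rank_le_add_three hS h3 (l := 2 * k + 1) ⟨k, rfl⟩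
        (ih (by omega)) (x := w) (by rintro rfl; omega) le_top (by omega) hu (by omega)
  have grade_pos := grade_strictMono (𝕆 := ℕ) (bot_lt_iff_ne_bot.2 hx)
  obtain rfl | hm := Nat.eq_zero_or_pos m
  · exact hE.hasBooleanAtomCounts_of_rank_le_two (by omega)
  · exact rank_le (m - 1) (by omega) x ⊤ hx (by omega)

theorem card_atoms_mul_of_even_rank (hE : IsEulerian P) (hS : IsSheffer P)
    (hbool : ∀ p : P, IsAtom p → HasBooleanAtomCounts p ⊤) (hl : Odd l)
    (htwo : ∀ z : P, 2 ≤ grade ℕ z → grade ℕ z ≤ l + 1 → (layer ⊥ z 1).card = 2)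
    (hx : grade ℕ x = l + 2) (hy : grade ℕ y = l + 3) :
    (layer ⊥ x 1).card * ((layer ⊥ y 1).card * l + 4) =
      2 * ((layer ⊥ y 1).card * (l + 2)) := by
  have grade_bot : grade ℕ (⊥ : P) = 0 := grade_bot
  refine hE.mul_card_layer_one_of_even_rank hl bot_le (by omega) (fun p hp => ?_)
    (fun i hi z hz => ?_) fun z hz => ?_
  · exact (hbool p (bot_covBy_iff.1 (mem_layer_one_iff_covBy.1 hp).1)).mono le_rfl le_top
  · have := (mem_layer.1 hz).2.2
    exact htwo z (by omega) (by omega)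
  · have := (mem_layer.1 hz).2.2
    exact hS.card_atoms_eq (n := l + 1) (by omega) hx

theorem card_atoms_eq_two_of_rank_le_add_three (hE : IsEulerian P) (hS : IsSheffer P)
    (hbool : ∀ p : P, IsAtom p → HasBooleanAtomCounts p ⊤)
    (h3 : ∀ z : P, grade ℕ z = 3 → (layer ⊥ z 1).card = 2) (hl : Odd l)
    (htwo : ∀ z : P, 2 ≤ grade ℕ z → grade ℕ z ≤ l + 1 → (layer ⊥ z 1).card = 2)
    (hy : grade ℕ y = l + 3) {z : P} (hz : 2 ≤ grade ℕ z) (hzl : grade ℕ z ≤ l + 3) :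
    (layer ⊥ z 1).card = 2 := by
  have grade_bot : grade ℕ (⊥ : P) = 0 := grade_bot
  obtain ⟨w, hw⟩ : (layer ⊥ y (l + 2)).Nonempty := layer_nonempty bot_le (by omega)
  have hgw : grade ℕ w = l + 2 := by
    have := (mem_layer.1 hw).2.2
    omega
  have relation := hE.card_atoms_mul_of_even_rank hS hbool hl htwo hgw hy
  have card_w : (layer ⊥ w 1).card = 2 := by
    obtain rfl | hl1 := eq_or_ne l 1
    · exact h3 w hgw
    have two_le : 2 ≤ l := by
      have := hl.pos
      omega
    have w_even : Even (layer ⊥ w 1).card := by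
      refine even_card_layer_one (by omega) (fun z hz => ?_) (fun z hz => ?_) fun p hp => ?_
      · exact h3 z (by have := (mem_layer.1 hz).2.2; omega)
      · have := (mem_layer.1 hz).2.2
        exact htwo z (by omega) (by omega)
      · exact (hbool p (bot_covBy_iff.1 (mem_layer_one_iff_covBy.1 hp).1)).mono le_rfl le_top
    have w_pos : 0 < (layer ⊥ w 1).card := Finset.card_pos.2 (layer_nonempty bot_le (by omega))
    exact eq_two_of_mul_eq_two_mul two_le w_even w_pos relation
  have card_y : (layer ⊥ y 1).card = 2 := by
    rw [card_w] at relation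
    linarith
  obtain hz_le | hz_eq | hz_eq : grade ℕ z ≤ l + 1 ∨ grade ℕ z = l + 2 ∨ grade ℕ z = l + 3 := by
    omega
  · exact htwo z hz hz_le
  · exact (hS.card_atoms_eq (n := l + 1) hz_eq hgw).trans card_w
  · exact (hS.card_atoms_eq (n := l + 2) hz_eq hy).trans card_y

theorem card_atoms_eq_two (hE : IsEulerian P) (hS : IsSheffer P)
    (hbool : ∀ p : P, IsAtom p → HasBooleanAtomCounts p ⊤)
    (h3 : ∀ z : P, grade ℕ z = 3 → (layer ⊥ z 1).card = 2)
    (htop : grade ℕ (⊤ : P) = 2 * m + 1) {z : P} (hz : 2 ≤ grade ℕ z) (hz_top : z ≠ ⊤) :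
    (layer ⊥ z 1).card = 2 := by
  have grade_bot : grade ℕ (⊥ : P) = 0 := grade_bot
  have rank_le (k : ℕ) (hk : k < m) : ∀ z : P, 2 ≤ grade ℕ z → grade ℕ z ≤ 2 * (k + 1) →
      (layer ⊥ z 1).card = 2 := by
    induction k with
    | zero => exact fun z hz hzk => hE.card_layer_one_of_rank_two bot_le (by omega)
    | succ k ih =>
      obtain ⟨y, hy⟩ : (layer (⊥ : P) ⊤ (2 * (k + 2))).Nonempty := layer_nonempty le_top (by omega)
      have hgy := (mem_layer.1 hy).2.2
      exact fun z hz hzk => hE.card_atoms_eq_two_of_rank_le_add_three hS hbool h3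
        (l := 2 * k + 1) ⟨k, rfl⟩ (ih (by omega)) (y := y) (by omega) hz (by omega)
  have := grade_strictMono (𝕆 := ℕ) (lt_top_iff_ne_top.2 hz_top)
  exact rank_le (m - 1) (by omega) z hz (by omega)

end IsEulerian

end ShefferPosets

section DualSuspension

open DualSuspension

theorem lt_coe_orderIso_Ici {P Q : Type*} [PartialOrder P] [PartialOrder Q] [OrderBot Q] {a : P}
    (ψ : Q ≃o Set.Ici a) {q : Q} (hq : q ≠ ⊥) : a < ψ q := by
  refine lt_of_le_of_ne (ψ q).2 fun h => hq (le_bot_iff.1 ?_)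
  rw [← ψ.le_iff_le]
  exact h.symm.trans_le (ψ ⊥).2

variable {P Q : Type*} [PartialOrder P] [BoundedOrder P] [PartialOrder Q] [BoundedOrder Q]

namespace DualSuspension

instance [Nontrivial Q] : BoundedOrder (DualSuspension Q) where
  bot := of ⊥
  bot_le
    | of x => (bot_le : ⊥ ≤ x)
    | new _ => (rfl : (⊥ : Q) = ⊥)
  top := of ⊤
  le_top
    | of x => (le_top : x ≤ ⊤)
    | new _ => (bot_lt_top : (⊥ : Q) < ⊤)

open Classical in
/-- The map `Σ*(Q) → P` that glues an isomorphism from `Q` to the upper interval `[a 0, ⊤]` of `P`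
to a second atom `a 1`: the two new elements go to `a 0` and `a 1`, and the least element of `Q`
goes to `⊥` instead of `a 0`. -/
noncomputable def glue (a : Fin 2 → P) (ψ : Q ≃o Set.Ici (a 0)) : DualSuspension Q → P
  | of x => if x = ⊥ then ⊥ else ψ x
  | new i => a i

variable {a : Fin 2 → P} {ψ : Q ≃o Set.Ici (a 0)} {i : Fin 2} {q : Q} {x y : DualSuspension Q}
  {z : P}

theorem glue_of (hq : q ≠ ⊥) : glue a ψ (of q) = ψ q :=
  if_neg hq

theorem glue_bot [Nontrivial Q] : glue a ψ ⊥ = ⊥ :=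
  if_pos rfl

theorem exists_le_glue [Nontrivial Q] (hx : x ≠ ⊥) : ∃ i, a i ≤ glue a ψ x := by
  match x with
  | of q =>
    have hq : q ≠ ⊥ := fun h => hx (congrArg of h)
    exact ⟨0, (lt_coe_orderIso_Ici ψ hq).le.trans_eq (glue_of hq).symm⟩
  | new i => exact ⟨i, le_rfl⟩

theorem glue_le_glue_iff [Nontrivial Q] (ha : ∀ i, IsAtom (a i)) (hinj : Function.Injective a)
    (hjoin : ∀ i z, a 0 < z → a i ≤ z) : glue a ψ x ≤ glue a ψ y ↔ x ≤ y := by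
  obtain rfl | hx := eq_or_ne x ⊥
  · simp [glue_bot]
  obtain rfl | hy := eq_or_ne y ⊥
  · obtain ⟨i, hi⟩ := exists_le_glue (a := a) (ψ := ψ) hx
    have : glue a ψ x ≠ ⊥ := ne_bot_of_le_ne_bot (ha i).1 hi
    simp [glue_bot, hx, this]
  match x, y with
  | of q, of r =>
    rw [glue_of fun h => hx (congrArg of h), glue_of fun h => hy (congrArg of h)]
    exact ψ.le_iff_le
  | of q, new i =>
    have hq : q ≠ ⊥ := fun h => hx (congrArg of h)
    rw [glue_of hq]
    exact iff_of_false
      (fun h => (ha 0).1 ((ha i).lt_iff.1 ((lt_coe_orderIso_Ici ψ hq).trans_le h))) hq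
  | new i, of r =>
    have hr : r ≠ ⊥ := fun h => hy (congrArg of h)
    rw [glue_of hr]
    exact iff_of_true (hjoin i _ (lt_coe_orderIso_Ici ψ hr)) (bot_lt_iff_ne_bot.2 hr)
  | new i, new j => exact ((ha j).le_iff_eq (ha i).1).trans hinj.eq_iff

theorem exists_glue_eq (ha : ∀ i, IsAtom (a i)) (hjoin : ∀ i z, a i < z → a 0 ≤ z) (hz : a i ≤ z) :
    ∃ x, glue a ψ x = z := by
  obtain rfl | hlt := hz.eq_or_lt
  · exact ⟨new i, rfl⟩
  obtain ⟨q, hq⟩ := ψ.surjective ⟨z, hjoin i z hlt⟩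
  refine ⟨of q, (glue_of ?_).trans (congrArg Subtype.val hq)⟩
  rintro rfl
  have hz_le : ψ ⊥ ≤ ⟨a 0, le_rfl⟩ := ψ.le_symm_apply.1 bot_le
  rw [hq] at hz_le
  exact (ha i).1 ((ha 0).lt_iff.1 (hlt.trans_le hz_le))

end DualSuspension

theorem nonempty_orderIso_withBot_withTop {Y : Type*} [PartialOrder Y] [Nontrivial P] (g : Y ↪o P)
    (hbot : ∀ a, g a ≠ ⊥) (htop : ∀ a, g a ≠ ⊤) (hsurj : ∀ z, z ≠ ⊥ → z ≠ ⊤ → ∃ a, g a = z) :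
    Nonempty (P ≃o WithBot (WithTop Y)) := by
  let G : WithBot (WithTop Y) → P := WithBot.recBotCoe ⊥ (WithTop.recTopCoe ⊤ g)
  have hG (a b : WithBot (WithTop Y)) : G a ≤ G b ↔ a ≤ b :=
    match a, b with
    | ⊥, _ => by simp [G]
    | ((⊤ : WithTop Y) : WithBot (WithTop Y)), ⊥ => by
      change (⊤ : P) ≤ ⊥ ↔ _
      simp
    | (((a : Y) : WithTop Y) : WithBot (WithTop Y)), ⊥ => by
      change g a ≤ ⊥ ↔ _
      simp [hbot]
    | _, ((⊤ : WithTop Y) : WithBot (WithTop Y)) => by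
      change _ ≤ (⊤ : P) ↔ _
      simp
    | ((⊤ : WithTop Y) : WithBot (WithTop Y)), (((b : Y) : WithTop Y) : WithBot (WithTop Y)) => by
      change ⊤ ≤ g b ↔ _
      simp [htop]
    | (((a : Y) : WithTop Y) : WithBot (WithTop Y)),
        (((b : Y) : WithTop Y) : WithBot (WithTop Y)) => by simp [G]
  refine ⟨(RelIso.ofSurjective (OrderEmbedding.ofMapLEIff G hG) fun z => ?_).symm⟩
  by_cases hzb : z = ⊥
  · exact ⟨⊥, hzb.symm⟩
  by_cases hzt : z = ⊤
  · exact ⟨((⊤ : WithTop Y) : WithBot (WithTop Y)), hzt.symm⟩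
  obtain ⟨a, ha⟩ := hsurj z hzb hzt
  exact ⟨((a : WithTop Y) : WithBot (WithTop Y)), ha⟩

theorem nonempty_orderIso_kSummation [Nontrivial P] {k : ℕ} (f : Fin k → Q ↪o P)
    (hbot : ∀ i, f i ⊥ = ⊥) (htop : ∀ i, f i ⊤ = ⊤)
    (hcomp : ∀ i j x y, x ≠ ⊥ → y ≠ ⊤ → f i x ≤ f j y → i = j)
    (hsurj : ∀ z, z ≠ ⊥ → z ≠ ⊤ → ∃ i x, f i x = z) : Nonempty (P ≃o KSummation k Q) := by
  let g : (Σ _ : Fin k, {x : Q // ¬ IsMin x ∧ ¬ IsMax x}) → P := fun x => f x.1 x.2.1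
  have hg (x y) : g x ≤ g y ↔ x ≤ y := by
    obtain ⟨i, x, hx⟩ := x
    obtain ⟨j, y, hy⟩ := y
    constructor
    · intro h
      obtain rfl := hcomp i j x y (by simpa using hx.1) (by simpa using hy.2) h
      exact Sigma.mk_le_mk_iff.2 ((f i).le_iff_le.1 h)
    · rintro ⟨_, _, _, h⟩
      exact (f i).le_iff_le.2 h
  refine nonempty_orderIso_withBot_withTop (OrderEmbedding.ofMapLEIff g hg) ?_ ?_ ?_
  · rintro ⟨i, x, hx⟩ h
    exact hx.1 (isMin_iff_eq_bot.2 ((f i).injective (h.trans (hbot i).symm)))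
  · rintro ⟨i, x, hx⟩ h
    exact hx.2 (isMax_iff_eq_top.2 ((f i).injective (h.trans (htop i).symm)))
  · intro z hz_bot hz_top
    obtain ⟨i, x, rfl⟩ := hsurj z hz_bot hz_top
    refine ⟨⟨i, x, ?_, ?_⟩, rfl⟩
    · rw [isMin_iff_eq_bot]
      rintro rfl
      exact hz_bot (hbot i)
    · rw [isMax_iff_eq_top]
      rintro rfl
      exact hz_top (htop i)

theorem nonempty_orderIso_kSummation_dualSuspension [Nontrivial P] [Nontrivial Q] {k : ℕ}
    (a : Fin k × Fin 2 → P) (ha : ∀ u, IsAtom (a u)) (hinj : Function.Injective a)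
    (hψ : ∀ u, Nonempty (Q ≃o Set.Ici (a u)))
    (hpair : ∀ u v z, a u < z → z ≠ ⊤ → (a v ≤ z ↔ u.1 = v.1))
    (hsurj : ∀ z, z ≠ ⊥ → ∃ u, a u ≤ z) :
    Nonempty (P ≃o KSummation k (DualSuspension Q)) := by
  let ψ (i : Fin k) : Q ≃o Set.Ici (a (i, 0)) := (hψ (i, 0)).some
  have hjoin (i : Fin k) (s t : Fin 2) (z : P) (hz : a (i, s) < z) : a (i, t) ≤ z := by
    obtain rfl | hz_top := eq_or_ne z ⊤
    · exact le_top
    · exact (hpair _ _ z hz hz_top).2 rfl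
  let f (i : Fin k) : DualSuspension Q ↪o P := OrderEmbedding.ofMapLEIff
    (glue (fun s => a (i, s)) (ψ i)) fun _ _ =>
      glue_le_glue_iff (fun s => ha (i, s)) (fun _ _ h => (Prod.ext_iff.1 (hinj h)).2)
        fun t z hz => hjoin i 0 t z hz
  have exists_eq (i : Fin k) (s : Fin 2) (z : P) (hz : a (i, s) ≤ z) : ∃ x, f i x = z :=
    exists_glue_eq (a := fun s => a (i, s)) (fun s => ha (i, s)) (fun t => hjoin i t 0) hz
  have map_bot (i : Fin k) : f i ⊥ = ⊥ := glue_bot (a := fun s => a (i, s)) (ψ := ψ i)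
  have map_top (i : Fin k) : f i ⊤ = ⊤ := by
    obtain ⟨x, hx⟩ := exists_eq i 0 ⊤ le_top
    exact top_le_iff.1 (hx ▸ (f i).monotone le_top)
  refine nonempty_orderIso_kSummation f map_bot map_top ?_ ?_
  · intro i j x y hx hy hxy
    obtain ⟨s, hs⟩ : ∃ s, a (i, s) ≤ f i x := exists_le_glue hx
    have hsy : a (i, s) ≤ f j y := hs.trans hxy
    have hy_bot : y ≠ ⊥ := by
      rintro rfl
      exact (ha (i, s)).1 (le_bot_iff.1 (hsy.trans_eq (map_bot j)))
    obtain ⟨t, ht⟩ : ∃ t, a (j, t) ≤ f j y := exists_le_glue hy_bot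
    obtain heq | hlt := ht.eq_or_lt
    · rw [← heq, (ha (j, t)).le_iff_eq (ha (i, s)).1] at hsy
      exact (Prod.ext_iff.1 (hinj hsy)).1
    · have hy_top : f j y ≠ ⊤ := fun h => hy ((f j).injective (h.trans (map_top j).symm))
      exact ((hpair (j, t) (i, s) _ hlt hy_top).1 hsy).symm
  · intro z hz _
    obtain ⟨⟨i, s⟩, hu⟩ := hsurj z hz
    exact ⟨i, exists_eq i s z hu⟩

end DualSuspension

section StructureTheorem

variable {P : Type*} [Finite P] [PartialOrder P] [BoundedOrder P] [GradeMinOrder ℕ P] {n : ℕ}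

theorem mem_layer_bot_one_iff {p z : P} : p ∈ layer ⊥ z 1 ↔ IsAtom p ∧ p ≤ z := by
  rw [mem_layer_one_iff_covBy, bot_covBy_iff]

theorem nonempty_orderIso_Ici {p : P} (hbool : HasBooleanAtomCounts p ⊤)
    (htop : grade ℕ (⊤ : P) = grade ℕ p + n) : Nonempty (BooleanLattice n ≃o Set.Ici p) := by
  obtain ⟨φ⟩ := hbool.nonempty_orderIso_finset le_top htop
  exact ⟨φ.symm.trans (OrderIso.setCongr _ _ Set.Icc_top)⟩

theorem exists_atom_pairing_of_ne_top (hn : 3 ≤ n) (htop : grade ℕ (⊤ : P) = n + 1)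
    (hbool : ∀ p : P, IsAtom p → HasBooleanAtomCounts p ⊤)
    (htwo : ∀ z : P, 2 ≤ grade ℕ z → z ≠ ⊤ → (layer ⊥ z 1).card = 2) :
    ∃ (k : ℕ) (a : Fin k × Fin 2 ≃ {p : P // IsAtom p}),
      ∀ u v (z : P), a u < z → z ≠ ⊤ → ((a v : P) ≤ z ↔ u.1 = v.1) := by
  have grade_bot : grade ℕ (⊥ : P) = 0 := grade_bot
  have mem_iff_isAtom (p : P) : p ∈ layer ⊥ ⊤ 1 ↔ IsAtom p := by simp [mem_layer_bot_one_iff]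
  have card_two (j : ℕ) (hj : 2 ≤ j) (hjn : j ≤ n) :
      ∀ z ∈ layer (⊥ : P) ⊤ j, (layer ⊥ z 1).card = 2 := fun z hz => by
    have := (mem_layer.1 hz).2.2
    exact htwo z (by omega) (by rintro rfl; omega)
  obtain ⟨k, a, ha⟩ := exists_atom_pairing (x := (⊥ : P)) (y := ⊤) (by omega)
    (card_two 3 (by omega) hn) (card_two 2 le_rfl (by omega))
    fun p hp => hbool p ((mem_iff_isAtom p).1 hp)
  refine ⟨k, a.trans (Equiv.subtypeEquivRight mem_iff_isAtom), fun u v z huz hz => ?_⟩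
  change (a u : P) < z at huz
  obtain ⟨e, he⟩ : (layer (a u : P) z 1).Nonempty :=
    layer_nonempty huz.le (grade_strictMono (𝕆 := ℕ) huz)
  obtain ⟨-, hez, hge⟩ := mem_layer.1 he
  have atoms_eq : layer ⊥ e 1 = layer ⊥ z 1 := layer_one_eq_of_card_le hez <| by
    have := (mem_layer.1 (a u).2).2.2
    have := grade_mono (𝕆 := ℕ) hez
    rw [htwo z (by omega) hz, htwo e (by omega) fun h => hz (top_le_iff.1 (h ▸ hez))]
  have mem_iff := Finset.ext_iff.1 atoms_eq (a v)
  rw [mem_layer_bot_one_iff, mem_layer_bot_one_iff] at mem_iff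
  rw [← ha u v e (layer_mono_right le_top he)]
  exact (and_congr_right_iff.1 mem_iff ((mem_iff_isAtom _).1 (a v).2)).symm

theorem exists_nonempty_orderIso_kSummation (hn : 3 ≤ n) (htop : grade ℕ (⊤ : P) = n + 1)
    (hbool : ∀ p : P, IsAtom p → HasBooleanAtomCounts p ⊤)
    (htwo : ∀ z : P, 2 ≤ grade ℕ z → z ≠ ⊤ → (layer ⊥ z 1).card = 2) :
    ∃ α : ℕ, 1 ≤ α ∧ Nonempty (P ≃o KSummation α (DualSuspension (BooleanLattice n))) := by
  obtain ⟨k, a, ha⟩ := exists_atom_pairing_of_ne_top hn htop hbool htwo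
  have grade_atom (u) : grade ℕ (a u : P) = 1 := by
    have := Nat.covBy_iff_add_one_eq.1 ((a u).2.bot_covBy.grade ℕ)
    rw [grade_bot, bot_eq_zero] at this
    omega
  have exists_le (z : P) (hz : z ≠ ⊥) : ∃ u, (a u : P) ≤ z := by
    obtain ⟨p, hp, hpz⟩ := exists_covBy_le_of_lt (bot_lt_iff_ne_bot.2 hz)
    obtain ⟨u, hu⟩ := a.surjective ⟨p, bot_covBy_iff.1 hp⟩
    exact ⟨u, by rwa [hu]⟩
  have : Nontrivial P := ⟨⊥, ⊤, fun h => by rw [← h, grade_bot, bot_eq_zero] at htop; omega⟩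
  have : NeZero n := ⟨by omega⟩
  obtain ⟨⟨i, _⟩, _⟩ := exists_le ⊤ top_ne_bot
  refine ⟨k, i.pos, nonempty_orderIso_kSummation_dualSuspension (fun u => (a u : P))
    (fun u => (a u).2) (Subtype.val_injective.comp a.injective) (fun u => ?_) ha exists_le⟩
  exact nonempty_orderIso_Ici (hbool _ (a u).2) (by rw [grade_atom, htop, add_comm])

end StructureTheorem

end EulerianSheffer

theorem mainTheorem5 {P : Type*} [Finite P] [PartialOrder P] [BoundedOrder P]
    [GradeMinOrder ℕ P]
    (hEulerian : EulerianSheffer.IsEulerian P)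
    (hSheffer : EulerianSheffer.IsSheffer P)
    (B D : ℕ → ℕ)
    (hB : EulerianSheffer.IsBinomialFactorialFunction P B)
    (hD : EulerianSheffer.IsShefferFactorialFunction P D)
    (m : ℕ) (hrank : grade ℕ (⊤ : P) = 2 * m + 1) (hm : 5 ≤ 2 * m + 1)
    (hB3 : B 3 = 6) (hD3 : D 3 = 4) :
    ∃ α : ℕ, 1 ≤ α ∧
      Nonempty (P ≃o EulerianSheffer.KSummation α
        (EulerianSheffer.DualSuspension (EulerianSheffer.BooleanLattice (2 * m)))) := by
  open EulerianSheffer in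
  have three_atoms (u v : P) (hu : u ≠ ⊥) (huv : u ≤ v) (hv : grade ℕ v = grade ℕ u + 3) :
      (layer u v 1).card = 3 := by
    have chains := hEulerian.numMaxChains_of_rank_three huv hv
    rw [hB 3 u v hu huv hv, hB3] at chains
    omega
  have two_atoms (z : P) (hz : grade ℕ z = 3) : (layer ⊥ z 1).card = 2 := by
    have chains := hEulerian.numMaxChains_of_rank_three (bot_le : ⊥ ≤ z)
      (by rw [hz, grade_bot, bot_eq_zero])
    rw [hD 3 z hz, hD3] at chains
    omega
  have upper_intervals (x : P) (hx : x ≠ ⊥) : HasBooleanAtomCounts x ⊤ :=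
    hEulerian.hasBooleanAtomCounts hSheffer three_atoms hrank hx
  have above_atoms (p : P) (hp : IsAtom p) : HasBooleanAtomCounts p ⊤ := upper_intervals p hp.1
  exact exists_nonempty_orderIso_kSummation (by omega) hrank above_atoms
    fun z => hEulerian.card_atoms_eq_two hSheffer above_atoms two_atoms hrank
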